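/- Let $E\neq 0$ be a complex Banach space and let $L$ be a finite-dimensional solvable complex Lie algebra acting on $E$ on the right by bounded operators, that is, let $\rho$ be a Lie algebra homomorphism from $L$ to the algebra $\mathcal L(E)$ of bounded linear operators on $E$ equipped with the opposite product, whose bracket is $[a,b]=ba-ab$ (for example, the inclusion of a finite-dimensional solvable Lie subalgebra $L\subseteq\mathcal L(E)$). Then for every $x$ in the derived algebra $L^2=[L,L]$ (the linear span of all brackets $[y,z]$ with $y,z\in L$), the operator $\rho(x)$ has spectrum $\mathrm{Sp}(\rho(x))=\{\lambda\in\mathbb C : \rho(x)-\lambda I \text{ is not invertible in } \mathcal L(E)\}=\{0\}$; that is, $\rho(x)$ is quasinilpotent. -/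

import Mathlib

/- An associative ring is regarded as a Lie ring with the commutator bracket `⁅a, b⁆ = a * b - b * a`. -/
attribute [local instance] LieRing.ofAssociativeRing

/-! ### Commutators in normed algebras -/

/-! Let `B` be the closed subalgebra generated by the image of `L`. On a simple quotient `B ⧸ M`,
every element of `L` acts by a scalar (`scalarIdeal_eq_top`), so `[L, L]` acts by zero. Its image
thus lies in every maximal left ideal, hence in the Jacobson radical, whose elements have spectrum
in `{0}`. If some element were not scalar, Lie's theorem modulo the scalar ideal would give an
operator `T` with `[y, T] = χ(y) T + c(y)`. Wintner's theorem and Schur's lemma exclude `χ = 0`;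
otherwise a translate of `T` is nilpotent with invariant kernel, hence zero. -/

theorem commutator_pow_of_commutator_eq_smul {A : Type*} [Ring A] [Algebra ℂ A] {a b : A} {c : ℂ}
    (h : a * b - b * a = c • b) (n : ℕ) : a * b ^ n - b ^ n * a = (n * c) • b ^ n := by
  induction n with
  | zero => simp
  | succ n ih =>
    have h1 : a * b ^ (n + 1) - b ^ (n + 1) * a
        = (a * b ^ n - b ^ n * a) * b + b ^ n * (a * b - b * a) := by
      rw [pow_succ]; noncomm_ring
    rw [h1, ih, h, smul_mul_assoc, mul_smul_comm, ← pow_succ, ← add_smul]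
    congr 1
    push_cast
    ring

theorem commutator_pow_of_commutator_eq_algebraMap {A : Type*} [Ring A] [Algebra ℂ A] {a b : A}
    {c : ℂ} (h : a * b - b * a = c • (1 : A)) (n : ℕ) :
    a * b ^ (n + 1) - b ^ (n + 1) * a = ((n + 1 : ℕ) * c) • b ^ n := by
  induction n with
  | zero => simpa using h
  | succ n ih =>
    have h1 : a * b ^ (n + 1 + 1) - b ^ (n + 1 + 1) * a
        = (a * b ^ (n + 1) - b ^ (n + 1) * a) * b + b ^ (n + 1) * (a * b - b * a) := by
      rw [pow_succ b (n + 1)]; noncomm_ring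
    rw [h1, ih, h, smul_mul_assoc, mul_smul_comm, mul_one, ← pow_succ, ← add_smul]
    congr 1
    push_cast
    ring

theorem norm_commutator_le {A : Type*} [NormedRing A] (a b : A) :
    ‖a * b - b * a‖ ≤ 2 * ‖a‖ * ‖b‖ := by
  calc ‖a * b - b * a‖ ≤ ‖a * b‖ + ‖b * a‖ := norm_sub_le _ _
    _ ≤ ‖a‖ * ‖b‖ + ‖b‖ * ‖a‖ := add_le_add (norm_mul_le _ _) (norm_mul_le _ _)
    _ = 2 * ‖a‖ * ‖b‖ := by ring

/-- Since `[a, b ^ n] = n c b ^ n` has norm at most `2‖a‖‖b ^ n‖`, the power vanishes once `n‖c‖ >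
2‖a‖`. -/
theorem isNilpotent_of_commutator_eq_smul {A : Type*} [NormedRing A] [NormedAlgebra ℂ A] {a b : A}
    {c : ℂ} (hc : c ≠ 0) (h : a * b - b * a = c • b) : IsNilpotent b := by
  obtain ⟨n, hn⟩ := exists_nat_gt (2 * ‖a‖ / ‖c‖)
  rw [div_lt_iff₀ (norm_pos_iff.2 hc)] at hn
  refine ⟨n, ?_⟩
  have h1 := norm_commutator_le a (b ^ n)
  rw [commutator_pow_of_commutator_eq_smul h, norm_smul, norm_mul, Complex.norm_natCast] at h1
  by_contra hb
  exact absurd (le_of_mul_le_mul_right h1 (norm_pos_iff.2 hb)) (not_le.2 hn)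

/-- **Wintner's theorem**: a nonzero multiple of the identity is not a commutator. -/
theorem eq_zero_of_commutator_eq_smul_one {A : Type*} [NormedRing A] [NormedAlgebra ℂ A]
    [Nontrivial A] {a b : A} {c : ℂ} (h : a * b - b * a = c • (1 : A)) : c = 0 := by
  by_contra hc
  have hcn := norm_pos_iff.2 hc
  -- As `[a, b ^ (n + 1)] = (n + 1) c b ^ n`, a vanishing power would force `1 = 0`.
  have descend : ∀ n : ℕ, b ^ n ≠ 0 := by
    intro n
    induction n with
    | zero => simp
    | succ n ih =>
      intro h0
      have h1 := commutator_pow_of_commutator_eq_algebraMap h n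
      rw [h0, mul_zero, zero_mul, sub_zero, eq_comm, smul_eq_zero] at h1
      refine h1.elim (fun h2 => ?_) ih
      exact (mul_ne_zero (Nat.cast_ne_zero.2 n.succ_ne_zero) hc) h2
  obtain ⟨n, hn⟩ := exists_nat_gt (2 * ‖a‖ * ‖b‖ / ‖c‖)
  rw [div_lt_iff₀ hcn] at hn
  have h1 := norm_commutator_le a (b ^ (n + 1))
  rw [commutator_pow_of_commutator_eq_algebraMap h, norm_smul, norm_mul,
    Complex.norm_natCast] at h1
  have h2 : ‖b ^ (n + 1)‖ ≤ ‖b‖ * ‖b ^ n‖ := by rw [pow_succ']; exact norm_mul_le _ _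
  have h3 : 2 * ‖a‖ * ‖b ^ (n + 1)‖ ≤ 2 * ‖a‖ * (‖b‖ * ‖b ^ n‖) :=
    mul_le_mul_of_nonneg_left h2 (by positivity)
  have h4 : (((n + 1 : ℕ) : ℝ) * ‖c‖) * ‖b ^ n‖ ≤ (2 * ‖a‖ * ‖b‖) * ‖b ^ n‖ := by
    calc _ ≤ _ := h1.trans h3
      _ = _ := by ring
  have h5 := le_of_mul_le_mul_right h4 (norm_pos_iff.2 (descend n))
  push_cast at h5
  linarith

/-! ### Simple Banach modules over a topologically generated algebra -/

section SimpleModule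

variable {B : Type*} [NormedRing B] [NormedAlgebra ℂ B]
  {X : Type*} [NormedAddCommGroup X] [NormedSpace ℂ X] [Module B X] [IsBoundedSMul B X]
  [IsScalarTower ℂ B X] {s : Set B}

/-- A closed subspace stable under topological generators is stable under the algebra. -/
theorem smul_mem_of_generators (hs : (Algebra.adjoin ℂ s).topologicalClosure = ⊤)
    {p : Submodule ℂ X} (hp : IsClosed (p : Set X)) (h : ∀ a ∈ s, ∀ x ∈ p, a • x ∈ p)
    (b : B) {x : X} (hx : x ∈ p) : b • x ∈ p := by
  let S : Subalgebra ℂ B :=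
    { carrier := {b | ∀ x ∈ p, b • x ∈ p}
      mul_mem' := fun {a b} ha hb x hx => by rw [mul_smul]; exact ha _ (hb _ hx)
      add_mem' := fun {a b} ha hb x hx => by rw [add_smul]; exact p.add_mem (ha _ hx) (hb _ hx)
      algebraMap_mem' := fun r x hx => by
        rw [algebraMap_smul]; exact p.smul_mem r hx }
  have hS : IsClosed (S : Set B) := by
    have : (S : Set B) = ⋂ x ∈ p, (fun b : B => b • x) ⁻¹' (p : Set X) := by
      ext b; simp [S]
    rw [this]
    exact isClosed_biInter fun x _ => hp.preimage (by fun_prop)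
  have h1 : (Algebra.adjoin ℂ s).topologicalClosure ≤ S :=
    Subalgebra.topologicalClosure_minimal (Algebra.adjoin_le (S := S) h) hS
  have : b ∈ S := h1 (hs ▸ Algebra.mem_top)
  exact this x hx

theorem eq_bot_or_eq_top_of_generators [IsSimpleModule B X]
    (hs : (Algebra.adjoin ℂ s).topologicalClosure = ⊤)
    {p : Submodule ℂ X} (hp : IsClosed (p : Set X)) (h : ∀ a ∈ s, ∀ x ∈ p, a • x ∈ p) :
    p = ⊥ ∨ p = ⊤ := by
  let q : Submodule B X :=
    { p with smul_mem' := fun b _ hx => smul_mem_of_generators hs hp h b hx }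
  refine (eq_bot_or_eq_top q).imp (fun hq => ?_) (fun hq => ?_)
  · exact SetLike.coe_injective (show (q : Set X) = _ by rw [hq]; rfl)
  · exact SetLike.coe_injective (show (q : Set X) = _ by rw [hq]; rfl)

/-- An operator commuting with topological generators commutes with the algebra. -/
theorem map_smul_of_generators (hs : (Algebra.adjoin ℂ s).topologicalClosure = ⊤)
    {T : X →L[ℂ] X} (h : ∀ a ∈ s, ∀ x, T (a • x) = a • T x) (b : B) (x : X) :
    T (b • x) = b • T x := by
  let S : Subalgebra ℂ B :=
    { carrier := {b | ∀ x, T (b • x) = b • T x}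
      mul_mem' := fun {a b} ha hb x => by rw [mul_smul, ha, hb, mul_smul]
      add_mem' := fun {a b} ha hb x => by rw [add_smul, map_add, ha, hb, add_smul]
      algebraMap_mem' := fun r x => by
        rw [algebraMap_smul, algebraMap_smul, map_smul] }
  have hS : IsClosed (S : Set B) := by
    have : (S : Set B) = ⋂ x, {b : B | T (b • x) = b • T x} := by
      ext b; simp [S]
    rw [this]
    exact isClosed_iInter fun x => isClosed_eq (by fun_prop) (by fun_prop)
  have h1 : (Algebra.adjoin ℂ s).topologicalClosure ≤ S :=
    Subalgebra.topologicalClosure_minimal (Algebra.adjoin_le (S := S) h) hS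
  have : b ∈ S := h1 (hs ▸ Algebra.mem_top)
  exact this x

/-- **Schur's lemma** for simple Banach modules. -/
theorem exists_eq_smul_of_generators [CompleteSpace X] [IsSimpleModule B X]
    (hs : (Algebra.adjoin ℂ s).topologicalClosure = ⊤)
    {T : X →L[ℂ] X} (h : ∀ a ∈ s, ∀ x, T (a • x) = a • T x) : ∃ c : ℂ, ∀ x, T x = c • x := by
  have : Nontrivial X := IsSimpleModule.nontrivial B X
  obtain ⟨c, hc⟩ := spectrum.nonempty T
  refine ⟨c, fun x => ?_⟩
  let f : X →ₗ[B] X :=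
    { toFun := fun x => c • x - T x
      map_add' := fun x y => by rw [map_add, smul_add]; abel
      map_smul' := fun b x => by
        rw [map_smul_of_generators hs h, RingHom.id_apply, smul_sub, smul_algebra_smul_comm] }
  rcases LinearMap.bijective_or_eq_zero f with hf | hf
  · refine absurd ?_ hc
    rw [spectrum.mem_resolventSet_iff, ContinuousLinearMap.isUnit_iff_bijective]
    convert hf using 1
    ext x
    simp [f, Algebra.algebraMap_eq_smul_one]
  · exact (sub_eq_zero.1 (LinearMap.congr_fun hf x)).symm

end SimpleModule

/-! ### Solvable Lie algebras in Banach algebras -/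

section Solvable

variable {L : Type*} [LieRing L] [LieAlgebra ℂ L]
  {B : Type*} [NormedRing B] [NormedAlgebra ℂ B] (φ : L →ₗ⁅ℂ⁆ B)
  (X : Type*) [NormedAddCommGroup X] [NormedSpace ℂ X] [Module B X] [IsBoundedSMul B X]
  [IsScalarTower ℂ B X]

/-- The elements of `L` acting on the module `X` by scalars. -/
def scalarIdeal : LieIdeal ℂ L where
  carrier := {y | ∃ c : ℂ, ∀ x : X, φ y • x = c • x}
  add_mem' := by
    rintro y z ⟨c, hc⟩ ⟨d, hd⟩
    exact ⟨c + d, fun x => by rw [map_add, add_smul, hc, hd, add_smul]⟩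
  zero_mem' := ⟨0, fun x => by simp⟩
  smul_mem' := by
    rintro r y ⟨c, hc⟩
    exact ⟨r * c, fun x => by rw [map_smul, smul_assoc, hc, mul_smul]⟩
  lie_mem := by
    rintro z y ⟨c, hc⟩
    refine ⟨0, fun x => ?_⟩
    rw [LieHom.map_lie, LieRing.of_associative_ring_bracket, sub_smul, mul_smul, mul_smul, hc, hc,
      smul_algebra_smul_comm, sub_self, zero_smul]

variable {X} in
theorem mem_scalarIdeal {y : L} :
    y ∈ scalarIdeal φ X ↔ ∃ c : ℂ, ∀ x : X, φ y • x = c • x := Iff.rfl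

variable {φ} in
theorem scalarIdeal_eq_top [FiniteDimensional ℂ L] [LieAlgebra.IsSolvable L] [CompleteSpace X]
    [IsSimpleModule B X]
    (hs : (Algebra.adjoin ℂ (Set.range φ)).topologicalClosure = ⊤) : scalarIdeal φ X = ⊤ := by
  have : Nontrivial X := IsSimpleModule.nontrivial B X
  by_contra hK
  set K := scalarIdeal φ X with hKdef
  have : Nontrivial (L ⧸ K) :=
    Submodule.Quotient.nontrivial_iff.2 (by simpa using hK)
  -- Lie's theorem: `w` is a common eigenvector modulo `K`.
  obtain ⟨χ, hχ⟩ := LieModule.exists_nontrivial_weightSpace_of_isSolvable ℂ L (L ⧸ K)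
  obtain ⟨⟨v, hv⟩, hv0⟩ := exists_ne (0 : LieModule.weightSpace (L ⧸ K) χ)
  obtain ⟨w, rfl⟩ := LieSubmodule.Quotient.surjective_mk' K v
  have hwK : w ∉ K := fun hw => hv0 (Subtype.ext ((LieSubmodule.Quotient.mk_eq_zero K).2 hw))
  rw [LieModule.mem_weightSpace] at hv
  have hmem : ∀ y, ⁅y, w⁆ - χ y • w ∈ K := fun y => by
    rw [← LieSubmodule.Quotient.mk_eq_zero, map_sub, map_smul, LieModuleHom.map_lie, hv, sub_self]
  choose c hc using fun y => (mem_scalarIdeal φ).1 (hmem y)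
  let P : B →L[ℂ] X →L[ℂ] X := ContinuousLinearMap.lsmul ℂ B
  let T := P (φ w)
  have hT : ∀ y, P (φ y) * T - T * P (φ y) = χ y • T + c y • 1 := by
    intro y
    ext x
    have := hc y x
    rw [map_sub, map_smul, LieHom.map_lie, LieRing.of_associative_ring_bracket, sub_smul, sub_smul,
      mul_smul, mul_smul, smul_assoc, sub_eq_iff_eq_add'] at this
    simpa [T, P] using this
  -- it suffices that some translate of `T` is a scalar
  have hscal : ∀ t d : ℂ, ¬ ∀ x, (T + t • 1) x = d • x := by
    intro t d h
    refine hwK ((mem_scalarIdeal φ).2 ⟨d - t, fun x => ?_⟩)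
    have := h x
    rw [sub_smul, eq_sub_iff_add_eq]
    simpa [T, P] using this
  by_cases hχ0 : ∀ y, χ y = 0
  · have hcomm : ∀ a ∈ Set.range φ, ∀ x, T (a • x) = a • T x := by
      rintro _ ⟨y, rfl⟩ x
      have h1 := hT y
      rw [hχ0, zero_smul, zero_add] at h1
      rw [eq_zero_of_commutator_eq_smul_one h1, zero_smul, sub_eq_zero] at h1
      simpa [P] using (DFunLike.congr_fun h1 x).symm
    obtain ⟨d, hd⟩ := exists_eq_smul_of_generators hs hcomm
    exact hscal 0 d (by simpa using hd)
  · push Not at hχ0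
    obtain ⟨y₀, hy₀⟩ := hχ0
    -- This translation absorbs the constant `c y₀`.
    let t := c y₀ / χ y₀
    let T' := T + t • 1
    have hT' : ∀ y, P (φ y) * T' - T' * P (φ y) = χ y • T' + (c y - χ y * t) • 1 := by
      intro y
      calc P (φ y) * T' - T' * P (φ y) = P (φ y) * T - T * P (φ y) := by
            simp only [T', mul_add, add_mul, mul_smul_comm, smul_mul_assoc, mul_one, one_mul]; abel
        _ = _ := by
            rw [hT]; simp only [T', smul_add, sub_smul, mul_smul]; abel
    have h₀ : P (φ y₀) * T' - T' * P (φ y₀) = χ y₀ • T' := by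
      rw [hT', show c y₀ - χ y₀ * t = 0 by simp only [t]; field_simp; simp, zero_smul, add_zero]
    have hnorm : ∀ y, P (φ y) * T' - T' * P (φ y) = χ y • T' := by
      intro y
      set d := c y - χ y * t with hd
      -- By the Jacobi identity the leftover constant `d` yields a scalar commutator, so Wintner's
      -- theorem kills it.
      have hJ : (P (φ y₀) * P (φ y) - P (φ y) * P (φ y₀)) * T'
          - T' * (P (φ y₀) * P (φ y) - P (φ y) * P (φ y₀)) = (-(χ y₀ * d)) • 1 := by
        have e : (P (φ y₀) * P (φ y) - P (φ y) * P (φ y₀)) * T'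
          - T' * (P (φ y₀) * P (φ y) - P (φ y) * P (φ y₀))
          = (P (φ y₀) * (P (φ y) * T' - T' * P (φ y))
              - (P (φ y) * T' - T' * P (φ y)) * P (φ y₀))
            - (P (φ y) * (P (φ y₀) * T' - T' * P (φ y₀))
              - (P (φ y₀) * T' - T' * P (φ y₀)) * P (φ y)) := by noncomm_ring
        rw [e, h₀, hT' y, mul_add, add_mul]
        simp only [mul_smul_comm, smul_mul_assoc, mul_one, one_mul]
        calc _ = χ y • (P (φ y₀) * T' - T' * P (φ y₀))
              - χ y₀ • (P (φ y) * T' - T' * P (φ y)) := by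
              simp only [smul_sub]; abel
          _ = _ := by rw [h₀, hT' y, ← hd]; module
      have hd0 := eq_zero_of_commutator_eq_smul_one hJ
      rw [neg_eq_zero, mul_eq_zero, or_iff_right hy₀] at hd0
      rw [hT' y, ← hd, hd0, zero_smul, add_zero]
    have hker := eq_bot_or_eq_top_of_generators (p := LinearMap.ker T'.toLinearMap) hs
      T'.isClosed_ker (by
        rintro _ ⟨y, rfl⟩ x hx
        have h1 := DFunLike.congr_fun (hnorm y) x
        have hx' : T' x = 0 := hx
        have h2 : φ y • T' x - T' (φ y • x) = χ y • T' x := by simpa [P] using h1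
        rw [hx', smul_zero, smul_zero, zero_sub, neg_eq_zero] at h2
        exact h2)
    rcases hker with hker | hker
    · obtain ⟨n, hn⟩ := isNilpotent_of_commutator_eq_smul hy₀ h₀
      have hinj : Function.Injective T' := LinearMap.ker_eq_bot.1 hker
      obtain ⟨x, hx⟩ := exists_ne (0 : X)
      refine hx ((hinj.iterate n) ?_)
      rw [← FunLike.coe_pow_eq_iterate, hn]
      rfl
    · exact hscal t 0 fun x => by
        rw [zero_smul]
        exact LinearMap.congr_fun (LinearMap.ker_eq_top.1 hker) x

variable {φ} in
theorem smul_eq_zero_of_mem_derived [FiniteDimensional ℂ L] [LieAlgebra.IsSolvable L]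
    [CompleteSpace X] [IsSimpleModule B X]
    (hs : (Algebra.adjoin ℂ (Set.range φ)).topologicalClosure = ⊤)
    {y : L} (hy : y ∈ ⁅(⊤ : LieIdeal ℂ L), (⊤ : LieIdeal ℂ L)⁆) (x : X) : φ y • x = 0 := by
  have htop : ∀ z, ∃ c : ℂ, ∀ x : X, φ z • x = c • x := fun z =>
    (mem_scalarIdeal φ).1 (scalarIdeal_eq_top X hs ▸ LieSubmodule.mem_top z)
  rw [← LieSubmodule.mem_toSubmodule, LieSubmodule.lieIdeal_oper_eq_linear_span'] at hy
  induction hy using Submodule.span_induction with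
  | mem _ h =>
    obtain ⟨y, -, z, -, rfl⟩ := h
    obtain ⟨c, hc⟩ := htop z
    rw [LieHom.map_lie, LieRing.of_associative_ring_bracket, sub_smul, mul_smul, mul_smul, hc, hc,
      smul_algebra_smul_comm, sub_self]
  | zero => rw [map_zero, zero_smul]
  | add _ _ _ _ h1 h2 => rw [map_add, add_smul, h1, h2, add_zero]
  | smul _ _ _ h => rw [map_smul, smul_assoc, h, smul_zero]

theorem isBoundedSMul_quotient {B : Type*} [NormedRing B] (M : Ideal B) [IsClosed (M : Set B)] :
    IsBoundedSMul B (B ⧸ M) := by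
  refine .of_norm_smul_le fun b x => le_of_forall_pos_le_add fun ε hε => ?_
  -- The `+ 1` covers `b = 0`.
  have hδ : 0 < ε / (‖b‖ + 1) := by positivity
  obtain ⟨a, rfl, ha⟩ := Submodule.Quotient.norm_mk_lt x hδ
  calc ‖b • (Submodule.Quotient.mk a : B ⧸ M)‖ = ‖(Submodule.Quotient.mk (b * a) : B ⧸ M)‖ := rfl
    _ ≤ ‖b * a‖ := Submodule.Quotient.norm_mk_le _ _
    _ ≤ ‖b‖ * ‖a‖ := norm_mul_le _ _
    _ ≤ ‖b‖ * (‖(Submodule.Quotient.mk a : B ⧸ M)‖ + ε / (‖b‖ + 1)) :=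
      mul_le_mul_of_nonneg_left ha.le (norm_nonneg _)
    _ ≤ ‖b‖ * ‖(Submodule.Quotient.mk a : B ⧸ M)‖ + ε := by
      rw [mul_add]
      gcongr
      rw [← mul_div_assoc, div_le_iff₀ (by positivity)]
      nlinarith [norm_nonneg b]

variable {φ} in
theorem mem_jacobson_of_mem_derived [FiniteDimensional ℂ L] [LieAlgebra.IsSolvable L]
    [CompleteSpace B] (hs : (Algebra.adjoin ℂ (Set.range φ)).topologicalClosure = ⊤)
    {y : L} (hy : y ∈ ⁅(⊤ : LieIdeal ℂ L), (⊤ : LieIdeal ℂ L)⁆) :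
    φ y ∈ (⊥ : Ideal B).jacobson := by
  refine Ideal.mem_sInf.2 ?_
  rintro M ⟨-, hM⟩
  have : IsClosed (M : Set B) := hM.isClosed
  have := isBoundedSMul_quotient M
  have : IsSimpleModule B (B ⧸ M) := isSimpleModule_iff_isCoatom.2 hM.out
  have h := smul_eq_zero_of_mem_derived (B ⧸ M) hs hy (Submodule.Quotient.mk 1)
  rwa [← Submodule.Quotient.mk_smul, Submodule.Quotient.mk_eq_zero, smul_eq_mul, mul_one] at h

end Solvable

/-! ### Jacobson radical and spectrum -/

theorem isUnit_one_sub_of_mem_jacobson_bot {R : Type*} [Ring R] {b : R}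
    (hb : b ∈ (⊥ : Ideal R).jacobson) : IsUnit (1 - b) := by
  have left : ∀ b ∈ (⊥ : Ideal R).jacobson, ∃ z, z * (1 - b) = 1 := by
    intro b hb
    obtain ⟨z, hz⟩ := Ideal.mem_jacobson_iff.1 hb (-1)
    refine ⟨z, ?_⟩
    rw [Ideal.mem_bot, sub_eq_zero] at hz
    calc z * (1 - b) = z * -1 * b + z := by noncomm_ring
      _ = 1 := hz
  obtain ⟨z, hz⟩ := left b hb
  -- The left inverse is `z = 1 + z * b`, again of the form one minus a radical element, so it has a
  -- left inverse too.
  obtain ⟨u, hu⟩ := left (-(z * b)) (neg_mem (Ideal.mul_mem_left _ _ hb))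
  have h1 : 1 - -(z * b) = z := by
    rw [mul_sub, mul_one, sub_eq_iff_eq_add] at hz
    rw [sub_neg_eq_add]
    exact hz.symm
  rw [h1] at hu
  have h2 : u = 1 - b := left_inv_eq_right_inv hu hz
  exact ⟨⟨1 - b, z, h2 ▸ hu, hz⟩, rfl⟩

theorem spectrum_subset_of_mem_jacobson_bot {B : Type*} [Ring B] [Algebra ℂ B] {b : B}
    (hb : b ∈ (⊥ : Ideal B).jacobson) : spectrum ℂ b ⊆ {0} := by
  intro r hr
  by_contra hr0
  have hr0 : r ≠ 0 := hr0
  refine hr ?_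
  have h1 : r⁻¹ • b ∈ (⊥ : Ideal B).jacobson := by
    rw [← algebraMap_smul B]; exact Ideal.mul_mem_left _ _ hb
  have h2 : algebraMap ℂ B r - b = Units.mk0 r hr0 • (1 - r⁻¹ • b) := by
    rw [Units.smul_def, Units.val_mk0, smul_sub, smul_smul, mul_inv_cancel₀ hr0, one_smul,
      Algebra.algebraMap_eq_smul_one]
  rw [spectrum.mem_resolventSet_iff, h2]
  exact (isUnit_one_sub_of_mem_jacobson_bot h1).smul _

/-- The derived algebra of a finite-dimensional solvable Lie algebra in a Banach algebra consists
of quasinilpotent elements. -/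
theorem spectrum_eq_zero_of_mem_derived {L : Type*} [LieRing L] [LieAlgebra ℂ L]
    [FiniteDimensional ℂ L] [LieAlgebra.IsSolvable L] {A : Type*} [NormedRing A] [NormedAlgebra ℂ A]
    [CompleteSpace A] [Nontrivial A] (ρ : L →ₗ⁅ℂ⁆ A) {x : L}
    (hx : x ∈ ⁅(⊤ : LieIdeal ℂ L), (⊤ : LieIdeal ℂ L)⁆) : spectrum ℂ (ρ x) = {0} := by
  let S := (Algebra.adjoin ℂ (Set.range ρ)).topologicalClosure
  have hmem : ∀ y, ρ y ∈ S := fun y =>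
    Subalgebra.le_topologicalClosure _ (Algebra.subset_adjoin ⟨y, rfl⟩)
  have : CompleteSpace S := (Subalgebra.isClosed_topologicalClosure _).completeSpace_coe
  let φ : L →ₗ⁅ℂ⁆ S :=
    { toFun := fun y => ⟨ρ y, hmem y⟩
      map_add' := fun y z => Subtype.ext (map_add ρ y z)
      map_smul' := fun c y => Subtype.ext (map_smul ρ c y)
      map_lie' := fun {y z} => Subtype.ext (LieHom.map_lie ρ y z) }
  have hs : (Algebra.adjoin ℂ (Set.range φ)).topologicalClosure = ⊤ := by
    have himg : (Algebra.adjoin ℂ (Set.range φ)).map S.val = Algebra.adjoin ℂ (Set.range ρ) := by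
      rw [AlgHom.map_adjoin, ← Set.range_comp]
      rfl
    rw [eq_top_iff]
    rintro ⟨b, hb⟩ -
    change _ ∈ closure _
    rw [Topology.IsInducing.subtypeVal.closure_eq_preimage_closure_image]
    change b ∈ closure (S.val '' _)
    have himg' : S.val '' (Algebra.adjoin ℂ (Set.range φ) : Set S)
        = (Algebra.adjoin ℂ (Set.range ρ) : Set A) := by
      rw [← himg, Subalgebra.coe_map]
    exact himg' ▸ hb
  -- Spectra can only shrink in the larger algebra.
  have hsub : spectrum ℂ (ρ x) ⊆ {0} :=
    (AlgHom.spectrum_apply_subset S.val (φ x)).trans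
      (spectrum_subset_of_mem_jacobson_bot (mem_jacobson_of_mem_derived hs hx))
  exact (Set.Nonempty.subset_singleton_iff (spectrum.nonempty _)).1 hsub

theorem proposition9
    {L : Type*} [LieRing L] [LieAlgebra ℂ L] [FiniteDimensional ℂ L] [LieAlgebra.IsSolvable L]
    {E : Type*} [NormedAddCommGroup E] [NormedSpace ℂ E] [CompleteSpace E] [Nontrivial E]
    (ρ : L →ₗ⁅ℂ⁆ (E →L[ℂ] E)ᵐᵒᵖ)
    (x : L) (hx : x ∈ ⁅(⊤ : LieIdeal ℂ L), (⊤ : LieIdeal ℂ L)⁆) :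
    spectrum ℂ (MulOpposite.unop (ρ x)) = {0} := by
  -- Invertibility, hence the spectrum, is the same in the opposite algebra.
  rw [← spectrum_eq_zero_of_mem_derived ρ hx]
  ext r
  rw [spectrum.mem_iff, spectrum.mem_iff, not_iff_not, ← isUnit_op]
  rfl
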